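/- Consider a Poincaré invariant classical field theory in $(n+1)$-dimensional Minkowski space-time. The field $\Phi=(\Phi_a)$ has finitely many components, each commuting ($p_a=0$) or anticommuting ($p_a=1$); their values lie in the even, respectively odd, part of a finite-dimensional supercommutative real algebra ($\mathbb R$ for purely commuting fields, a Grassmann algebra in general). The restricted Lorentz group, or a group covering it, acts linearly on the components. The theory has a smooth Lagrangian density $\mathscr L(x,\Phi,\partial\Phi)$ whose action is Poincaré invariant, canonical momentum $\pi_a=\partial\mathscr L/\partial(\partial_0\Phi_a)$, and a Lorentz invariant constant $c$ that the field approaches at infinity. The phase space at time $t$ consists of smooth $(\varphi,\pi)$ on $\mathbb R^n$ that equal their vacuum values outside a compact set, with the (generalised) canonical Poisson bracket $\{\varphi_a(\vec x),\pi_b(\vec y)\}=\delta_{ab}\,\delta(\vec x-\vec y)$, $\{\pi_b(\vec y),\varphi_a(\vec x)\}=-(-1)^{p_a}\delta_{ab}\,\delta(\vec x-\vec y)$. Let $j^\mu$ be a four-vector current, that is, a smooth function $j^\mu(x,\Phi,\partial\Phi,\dots,\partial^k\Phi)$ with $j^\mu[g\Phi](gx)=A^\mu{}_\nu\, j^\nu[\Phi](x)$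 for every Poincaré transformation $gx=Ax+b$. Suppose that for each $t$ its charge on the surface $\sigma$ of constant time $t$, $Q_t=\int_\sigma ds_\mu\, j^\mu=\int d^nx\; j^0(t,\vec x)$, exists and is a functional $Q_t(\varphi,\pi)$ of the canonical variables at time $t$, for all smooth field configurations (solutions or not) that equal $c$ outside a compact set of space-time. If, for every $t$, the charge generates no transformation, i.e. $$\{Q_t,\varphi_a(\vec x)\}=0\quad\text{and}\quad\{Q_t,\pi_a(\vec x)\}=0$$ everywhere on phase space and for all $a$, then the current is conserved identically (strongly, off-shell): the total divergence $d_\mu j^\mu$ vanishes at every point of space-time for every smooth field configuration $\Phi$, whether or not it solves the equation of motion. -/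

import Mathlib

open MeasureTheory
open scoped ContDiff

noncomputable section

namespace FieldTheory

/-! Spacetime of dimension `n + 1`, coordinate `0` being time. -/

/-- Minkowski spacetime of `n` space dimensions, in inertial coordinates `x⁰, x¹, …, xⁿ`. -/
abbrev Spacetime (n : ℕ) := Fin (n + 1) → ℝ

/-- Space: a surface of constant time. -/
abbrev Space (n : ℕ) := Fin n → ℝ

/-- The point of spacetime with time `t` and position `x`. -/
def event {n : ℕ} (t : ℝ) (x : Space n) : Spacetime n := Fin.cons t x

/-- The Minkowski product of signature `(+, -, …, -)`. -/
def minkowski {n : ℕ} (x y : Spacetime n) : ℝ :=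
  x 0 * y 0 - ∑ i : Fin n, x i.succ * y i.succ

/-- The proper orthochronous Lorentz transformations. -/
def IsRestrictedLorentz {n : ℕ} (A : Spacetime n ≃L[ℝ] Spacetime n) : Prop :=
  (∀ x y, minkowski (A x) (A y) = minkowski x y) ∧
  LinearMap.det ((A : Spacetime n →L[ℝ] Spacetime n) : Spacetime n →ₗ[ℝ] Spacetime n) = 1 ∧
  0 < A (Pi.single 0 1) 0

/-! Commuting and anticommuting c-number fields take values in the even and in the odd part of a
supercommutative algebra `G`: the real numbers for purely commuting fields, a Grassmann algebra
in general. -/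

section Fields

variable {κ G : Type*} [Fintype κ] [NormedRing G] [NormedAlgebra ℝ G]

/-- Homogeneous elements commute, except that odd ones anticommute with each other. -/
def IsSupercommutative (𝒢 : ZMod 2 → Submodule ℝ G) : Prop :=
  ∀ i j : ZMod 2, ∀ a ∈ 𝒢 i, ∀ b ∈ 𝒢 j, a * b = (-1 : G) ^ (i.val * j.val) * (b * a)

/-- The values of a field with components `κ` of parities `p`. -/
def HasParity (𝒢 : ZMod 2 → Submodule ℝ G) (p : κ → ZMod 2) (v : κ → G) : Prop :=
  ∀ a, v a ∈ 𝒢 (p a)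

/-- A smooth field (on spacetime or on space) with components of parities `p`.  No equation of
motion is imposed. -/
def IsField {E : Type*} [NormedAddCommGroup E] [NormedSpace ℝ E]
    (𝒢 : ZMod 2 → Submodule ℝ G) (p : κ → ZMod 2) (Φ : E → κ → G) : Prop :=
  ContDiff ℝ ∞ Φ ∧ ∀ x, HasParity 𝒢 p (Φ x)

/-- The action of the Poincaré transformation `x ↦ A x + b` on a field whose components are mixed
by `R`: `(gΦ)(x) = R Φ(g⁻¹ x)`. -/
def poincareAct {n : ℕ} (A : Spacetime n ≃L[ℝ] Spacetime n) (R : (κ → G) →L[ℝ] (κ → G))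
    (b : Spacetime n) (Φ : Spacetime n → κ → G) : Spacetime n → κ → G :=
  fun x => R (Φ (A.symm (x - b)))

/-- The change `S[Φ + δ] - S[Φ]` of the action `S = ∫ L(x, Φ, ∂Φ)` under a variation `δ` of compact
support.  (The actions themselves need not be finite.) -/
def actionChange {n : ℕ} (L : Spacetime n → (κ → G) → (Spacetime n →L[ℝ] (κ → G)) → G)
    (Φ δ : Spacetime n → κ → G) : G :=
  ∫ x, (L x (Φ x + δ x) (fderiv ℝ (fun y => Φ y + δ y) x) - L x (Φ x) (fderiv ℝ Φ x))

/-- The linear map `dx⁰ ⊗ v`: the value of `∂Φ` when `∂₀Φ = v` and the space derivatives vanish. -/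
def velocity {n : ℕ} (v : κ → G) : Spacetime n →L[ℝ] (κ → G) :=
  (ContinuousLinearMap.proj (R := ℝ) (φ := fun _ : Fin (n + 1) => ℝ) 0).smulRight v

/-- `P` is the canonical momentum `π_a = ∂L/∂(∂₀Φ_a)` (left derivative: a variation `h` of `∂₀Φ_a`,
of the parity of that component, changes `L` by `h π_a`), of the same parity as `Φ_a`. -/
def IsCanonicalMomentum {n : ℕ} [DecidableEq κ] (𝒢 : ZMod 2 → Submodule ℝ G) (p : κ → ZMod 2)
    (L : Spacetime n → (κ → G) → (Spacetime n →L[ℝ] (κ → G)) → G)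
    (P : Spacetime n → (κ → G) → (Spacetime n →L[ℝ] (κ → G)) → κ → G) : Prop :=
  ContDiff ℝ ∞ (fun q : Spacetime n × (κ → G) × (Spacetime n →L[ℝ] (κ → G)) =>
    P q.1 q.2.1 q.2.2) ∧
  ∀ x v w, HasParity 𝒢 p v → (∀ u, HasParity 𝒢 p (w u)) →
    HasParity 𝒢 p (P x v w) ∧
    ∀ a, ∀ h ∈ 𝒢 (p a),
      HasDerivAt (fun s : ℝ => L x v (w + s • velocity (Pi.single a h))) (h * P x v w a) 0

end Fields

/-- A Poincaré invariant field theory in `n + 1` dimensions, of a field with components `κ`.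
`S` is the restricted Lorentz group or a group covering it (as is needed for spinors). -/
structure RelativisticFieldTheory (n : ℕ) (κ : Type*) [Fintype κ] [DecidableEq κ]
    {G : Type*} [NormedRing G] [NormedAlgebra ℝ G] (𝒢 : ZMod 2 → Submodule ℝ G)
    (S : Type*) [Group S] where
  /-- which components are commuting (`0`) and which anticommuting (`1`) -/
  parity : κ → ZMod 2
  /-- the Lorentz transformation of spacetime -/
  lorentz : S →* (Spacetime n ≃L[ℝ] Spacetime n)
  lorentz_range : ∀ A, (∃ s, lorentz s = A) ↔ IsRestrictedLorentz A
  /-- the representation that acts on the components of the field -/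
  rep : S →* ((κ → G) →L[ℝ] (κ → G))
  rep_parity : ∀ s v, HasParity 𝒢 parity v → HasParity 𝒢 parity (rep s v)
  /-- the Lorentz invariant constant that the field approaches at infinity -/
  vacuum : κ → G
  vacuum_parity : HasParity 𝒢 parity vacuum
  vacuum_invariant : ∀ s, rep s vacuum = vacuum
  /-- the Lagrangian density `L(x, Φ, ∂Φ)` -/
  lagrangian : Spacetime n → (κ → G) → (Spacetime n →L[ℝ] (κ → G)) → G
  lagrangian_smooth :
    ContDiff ℝ ∞ (fun q : Spacetime n × (κ → G) × (Spacetime n →L[ℝ] (κ → G)) =>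
      lagrangian q.1 q.2.1 q.2.2)
  lagrangian_even : ∀ x v w, HasParity 𝒢 parity v → (∀ u, HasParity 𝒢 parity (w u)) →
    lagrangian x v w ∈ 𝒢 0
  /-- Poincaré invariance of the action -/
  invariant : ∀ (s : S) (b : Spacetime n) (Φ δ : Spacetime n → κ → G),
    IsField 𝒢 parity Φ → IsField 𝒢 parity δ → HasCompactSupport δ →
    actionChange lagrangian (poincareAct (lorentz s) (rep s) b Φ)
      (poincareAct (lorentz s) (rep s) b δ) = actionChange lagrangian Φ δ
  /-- the canonical momentum as a function of `x`, `Φ`, `∂Φ` -/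
  momentum : Spacetime n → (κ → G) → (Spacetime n →L[ℝ] (κ → G)) → κ → G
  momentum_spec : IsCanonicalMomentum 𝒢 parity lagrangian momentum

/-! Canonical formalism at a fixed time: a functional `F(φ, π)` of the canonical variables. -/

section Bracket

variable {n : ℕ} {κ G : Type*} [Fintype κ] [DecidableEq κ] [NormedRing G] [NormedAlgebra ℝ G]

/-- A smooth variation of compact support of a component of parity `i`. -/
def IsVariation (𝒢 : ZMod 2 → Submodule ℝ G) (i : ZMod 2) (h : Space n → G) : Prop :=
  ContDiff ℝ ∞ h ∧ HasCompactSupport h ∧ ∀ y, h y ∈ 𝒢 i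

/-- `b(y)` is the bracket `{F, π_a(y)}` at the phase space point `(φ, π)`.  In the generalised
Poisson bracket
`{F, K} = ∑_a ∫ (δ_R F/δφ_a · δ_L K/δπ_a - (-1)^{p_a} δ_R F/δπ_a · δ_L K/δφ_a)`
it is the right functional derivative `δ_R F/δφ_a(y)`, as a distribution in `y`. -/
def HasBracketWithMomentum (𝒢 : ZMod 2 → Submodule ℝ G) (p : κ → ZMod 2)
    (F : (Space n → κ → G) → (Space n → κ → G) → G) (φ π : Space n → κ → G) (a : κ)
    (b : Space n → G) : Prop :=
  ∀ h, IsVariation 𝒢 (p a) h →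
    HasDerivAt (fun s : ℝ => F (fun y => φ y + s • (Pi.single a (h y) : κ → G)) π) (∫ y, b y * h y) 0

/-- `b(y)` is the bracket `{F, φ_a(y)} = -(-1)^{p_a} δ_R F/δπ_a(y)` at the phase space point
`(φ, π)`. -/
def HasBracketWithField (𝒢 : ZMod 2 → Submodule ℝ G) (p : κ → ZMod 2)
    (F : (Space n → κ → G) → (Space n → κ → G) → G) (φ π : Space n → κ → G) (a : κ)
    (b : Space n → G) : Prop :=
  ∀ h, IsVariation 𝒢 (p a) h →
    HasDerivAt (fun s : ℝ => F φ (fun y => π y + s • (Pi.single a (h y) : κ → G)))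
      (-((-1 : G) ^ (p a).val * ∫ y, b y * h y)) 0

/-- A smeared component of a canonical variable, varied. -/
theorem hasDerivAt_smeared (f : Space n → ℝ) (hf : Continuous f) (hfc : HasCompactSupport f)
    (φ : Space n → κ → G) (hφ : Continuous φ) (a c : κ) (h : Space n → G) (hh : Continuous h) :
    HasDerivAt (fun s : ℝ => ∫ y, f y • (φ y + s • (Pi.single a (h y) : κ → G)) c)
      (∫ y, (if a = c then f y • (1 : G) else 0) * h y) 0 := by
  have h1 : Integrable (fun y => f y • φ y c) :=
    (hf.smul ((continuous_apply c).comp hφ)).integrable_of_hasCompactSupport hfc.smul_right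
  have h2 : Integrable (fun y => f y • h y) :=
    (hf.smul hh).integrable_of_hasCompactSupport hfc.smul_right
  by_cases hac : a = c
  · subst hac
    have e : (fun s : ℝ => ∫ y, f y • (φ y + s • (Pi.single a (h y) : κ → G)) a) =
        fun s : ℝ => (∫ y, f y • φ y a) + s • ∫ y, f y • h y := by
      funext s
      rw [← integral_smul]
      have h3 : Integrable (fun y => s • f y • h y) := h2.smul s
      rw [← integral_add h1 h3]
      refine integral_congr_ae (Filter.Eventually.of_forall fun y => ?_)
      simp [smul_add, smul_comm s (f y)]
    rw [e]
    simpa using ((hasDerivAt_id (0 : ℝ)).smul_const (∫ y, f y • h y)).const_add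
      (∫ y, f y • φ y a)
  · have hca : c ≠ a := fun e => hac e.symm
    simpa [hac, hca, Pi.single_apply] using
      hasDerivAt_const (0 : ℝ) (∫ y, f y • φ y c)

/-- The canonical bracket `{φ_c(x), π_a(y)} = δ_{ca} δ(x - y)`, smeared in `x` with `f`. -/
theorem canonical_bracket (𝒢 : ZMod 2 → Submodule ℝ G) (p : κ → ZMod 2)
    (f : Space n → ℝ) (hf : Continuous f) (hfc : HasCompactSupport f)
    (φ π : Space n → κ → G) (hφ : IsField 𝒢 p φ) (a c : κ) :
    HasBracketWithMomentum 𝒢 p (fun φ _ => ∫ x, f x • φ x c) φ π a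
      (fun y => if a = c then f y • (1 : G) else 0) :=
  fun h hh => hasDerivAt_smeared f hf hfc φ hφ.1.continuous a c h hh.1.continuous

/-- The canonical bracket `{π_c(x), φ_a(y)} = -(-1)^{p_a} δ_{ca} δ(x - y)`, smeared in `x`. -/
theorem canonical_bracket' (𝒢 : ZMod 2 → Submodule ℝ G) (p : κ → ZMod 2)
    (f : Space n → ℝ) (hf : Continuous f) (hfc : HasCompactSupport f)
    (φ π : Space n → κ → G) (hπ : IsField 𝒢 p π) (a c : κ) :
    HasBracketWithField 𝒢 p (fun _ π => ∫ x, f x • π x c) φ π a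
      (fun y => if a = c then -((-1 : G) ^ (p a).val * (f y • (1 : G))) else 0) := by
  intro h hh
  have key := hasDerivAt_smeared f hf hfc π hπ.1.continuous a c h hh.1.continuous
  convert key using 1
  by_cases hac : a = c
  · subst hac
    rcases neg_one_pow_eq_or G (p a).val with e | e <;> simp [e, integral_neg]
  · simp [hac]

end Bracket

/-! Currents. -/

/-- The values at a point of the derivatives of orders `0, …, k` of a field. -/
abbrev Jet (n : ℕ) (κ G : Type*) [Fintype κ] [NormedRing G] [NormedAlgebra ℝ G] (k : ℕ) :=
  (i : Fin (k + 1)) → (Spacetime n) [×(i : ℕ)]→L[ℝ] (κ → G)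

/-- A current: a smooth function of the coordinates, the fields, and finitely many derivatives of
the fields. -/
structure LocalCurrent (n : ℕ) (κ G : Type*) [Fintype κ] [NormedRing G] [NormedAlgebra ℝ G] where
  order : ℕ
  toFun : Spacetime n → Jet n κ G order → Fin (n + 1) → G
  smooth : ContDiff ℝ ∞ (fun q : Spacetime n × Jet n κ G order => toFun q.1 q.2)

section Currents

variable {n : ℕ} {κ G : Type*} [Fintype κ] [NormedRing G] [NormedAlgebra ℝ G]

/-- The component `j^μ(x)` of the current in the field configuration `Φ`. -/
def LocalCurrent.eval (j : LocalCurrent n κ G) (Φ : Spacetime n → κ → G) (x : Spacetime n)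
    (μ : Fin (n + 1)) : G :=
  j.toFun x (fun i => iteratedFDeriv ℝ i Φ x) μ

/-- The total divergence `d_μ j^μ` in the field configuration `Φ`. -/
def LocalCurrent.divergence (j : LocalCurrent n κ G) (Φ : Spacetime n → κ → G)
    (x : Spacetime n) : G :=
  ∑ μ, fderiv ℝ (fun y => j.eval Φ y μ) x (Pi.single μ 1)

/-- The charge `∫_σ ds_μ j^μ = ∫ dV j⁰` on the surface `σ` of constant time `t`. -/
def LocalCurrent.charge (j : LocalCurrent n κ G) (t : ℝ) (Φ : Spacetime n → κ → G) : G :=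
  ∫ x : Space n, j.eval Φ (event t x) 0

end Currents

namespace RelativisticFieldTheory

variable {n : ℕ} {κ : Type*} [Fintype κ] [DecidableEq κ]
  {G : Type*} [NormedRing G] [NormedAlgebra ℝ G] {𝒢 : ZMod 2 → Submodule ℝ G}
  {S : Type*} [Group S]

/-- A field configuration on spacetime, on- or off-shell, which equals the vacuum outside a compact
set. -/
def IsHistory (T : RelativisticFieldTheory n κ 𝒢 S) (Φ : Spacetime n → κ → G) : Prop :=
  IsField 𝒢 T.parity Φ ∧ HasCompactSupport (fun x => Φ x - T.vacuum)

/-- The canonical field `φ` at time `t`. -/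
def fieldAt (_T : RelativisticFieldTheory n κ 𝒢 S) (t : ℝ) (Φ : Spacetime n → κ → G) :
    Space n → κ → G :=
  fun x => Φ (event t x)

/-- The canonical momentum `π` at time `t`. -/
def momentumAt (T : RelativisticFieldTheory n κ 𝒢 S) (t : ℝ) (Φ : Spacetime n → κ → G) :
    Space n → κ → G :=
  fun x => T.momentum (event t x) (Φ (event t x)) (fderiv ℝ Φ (event t x))

/-- The phase space at time `t`: canonical variables that have their vacuum values outside a
compact set. -/
def IsPhasePoint (T : RelativisticFieldTheory n κ 𝒢 S) (t : ℝ) (φ π : Space n → κ → G) : Prop :=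
  IsField 𝒢 T.parity φ ∧ IsField 𝒢 T.parity π ∧
  HasCompactSupport (fun x => φ x - T.vacuum) ∧
  HasCompactSupport (fun x => π x - T.momentumAt t (fun _ => T.vacuum) x)

/-- `Q t` expresses the charge of `j` at time `t` through the canonical variables `φ` and `π`:
the charge exists, and it is the functional `Q t` of them, in all field configurations. -/
def IsCanonicalCharge (T : RelativisticFieldTheory n κ 𝒢 S) (j : LocalCurrent n κ G)
    (Q : ℝ → (Space n → κ → G) → (Space n → κ → G) → G) : Prop :=
  ∀ t Φ, T.IsHistory Φ →
    Integrable (fun x : Space n => j.eval Φ (event t x) 0) ∧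
    j.charge t Φ = Q t (T.fieldAt t Φ) (T.momentumAt t Φ)

/-- The current is a four-vector: `j^μ[gΦ](gx) = A^μ_ν j^ν[Φ](x)` for every Poincaré transformation
`g x = A x + b`. -/
def IsFourVector (T : RelativisticFieldTheory n κ 𝒢 S) (j : LocalCurrent n κ G) : Prop :=
  ∀ (s : S) (b : Spacetime n) (Φ : Spacetime n → κ → G), IsField 𝒢 T.parity Φ → ∀ x μ,
    j.eval (poincareAct (T.lorentz s) (T.rep s) b Φ) (T.lorentz s x + b) μ =
      ∑ ν, (T.lorentz s (Pi.single ν 1) μ) • j.eval Φ x ν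

/-- Strong (identical, off-shell) conservation: `d_μ j^μ = 0` in all field configurations, whether
or not they solve the equation of motion and whatever they do at infinity. -/
def StronglyConserved (T : RelativisticFieldTheory n κ 𝒢 S) (j : LocalCurrent n κ G) : Prop :=
  ∀ Φ, IsField 𝒢 T.parity Φ → ∀ x, j.divergence Φ x = 0

end RelativisticFieldTheory

end FieldTheory

end

/-! Vanishing brackets make `Q t` constant on phase space, which is affine: one reaches the vacuum
by moving one component at a time along a segment (`functional_eq_of_hasDerivAt_zero`). So every
history has the charge of the vacuum, and the excess J of its current over the vacuum current, which
has compact support, has zero flux through every surface of constant time. The same holds for all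
Lorentz transforms of the history; since the current is a four-vector, J has zero flux through every
spacelike hyperplane.

In terms of moments, ∫ (ξ·J)(ξ·x)^m = 0 for every future timelike covector ξ
(`exists_restrictedLorentz_of_isFutureTimelike` supplies the boost). These integrals are polynomial
in ξ and the timelike cone is open, so they vanish for all ξ. Summing the exponential series gives ∫
(ξ·J) exp(ξ·x) = 0, and integration by parts turns this into the vanishing of the Laplace transform
of div J. Hence div J = 0 (`divergence_eq_zero_of_moments`).

Translation covariance makes the vacuum current constant, so div j = div J on histories. The
divergence at a point depends only on the germ of the field there, and a cutoff makes any field a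
history near the point. -/

/-! ### Integrals of powers and exponentials against a function of compact support. -/

section Analysis

variable {X : Type*} [TopologicalSpace X] [MeasurableSpace X] [BorelSpace X]
  {μ : Measure X} [IsFiniteMeasureOnCompacts μ]

/-- An integral of `a (c + s d) ^ m` depends polynomially on `s`. -/
theorem exists_polynomial_integral_mul_pow {c d : X → ℝ} (hc : Continuous c)
    (hd : Continuous d) (m : ℕ) : ∀ {a : X → ℝ}, Continuous a → HasCompactSupport a →
    ∃ P : Polynomial ℝ, ∀ s : ℝ, ∫ x, a x * (c x + s * d x) ^ m ∂μ = P.eval s := by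
  induction m with
  | zero => exact fun {a} _ _ => ⟨Polynomial.C (∫ x, a x ∂μ), fun s => by simp⟩
  | succ m ih =>
    intro a ha hac
    -- One factor c + s d is absorbed into the weight, which becomes a c + s (a d).
    obtain ⟨P, hP⟩ := ih (ha.mul hc) hac.mul_right
    obtain ⟨R, hR⟩ := ih (ha.mul hd) hac.mul_right
    refine ⟨P + Polynomial.X * R, fun s => ?_⟩
    have hcd : Continuous fun x => (c x + s * d x) ^ m := by fun_prop
    rw [Polynomial.eval_add, Polynomial.eval_mul, Polynomial.eval_X, ← hP, ← hR,
      ← integral_const_mul, ← integral_add]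
    · exact integral_congr_ae (Filter.Eventually.of_forall fun x => by
        simp only [Pi.mul_apply]; ring)
    · exact ((ha.mul hc).mul hcd).integrable_of_hasCompactSupport hac.mul_right.mul_right
    · exact (((ha.mul hd).mul hcd).integrable_of_hasCompactSupport
        hac.mul_right.mul_right).const_mul s

/-- On the support of a the function c is bounded, so the exponential series may be integrated term
by term. -/
theorem integral_mul_exp_eq_zero {a c : X → ℝ} (ha : Continuous a) (hac : HasCompactSupport a)
    (hc : Continuous c) (h : ∀ m : ℕ, ∫ x, a x * c x ^ m ∂μ = 0) :
    ∫ x, a x * Real.exp (c x) ∂μ = 0 := by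
  have hint : ∀ m : ℕ, Integrable (fun x => a x * c x ^ m / (m.factorial : ℝ)) μ := fun m =>
    ((ha.mul (hc.pow m)).integrable_of_hasCompactSupport hac.mul_right).div_const _
  obtain ⟨M, hM⟩ := hac.isCompact.exists_bound_of_continuousOn hc.continuousOn
  have hM' : ∀ x, a x ≠ 0 → ‖c x‖ ≤ M := fun x hx => hM x (subset_tsupport a hx)
  have hsum : Summable fun m : ℕ => ∫ x, ‖a x * c x ^ m / (m.factorial : ℝ)‖ ∂μ := by
    refine Summable.of_nonneg_of_le (fun m => integral_nonneg fun x => norm_nonneg _)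
      (fun m => ?_) ((Real.summable_pow_div_factorial M).mul_left (∫ x, ‖a x‖ ∂μ))
    rw [← integral_mul_const]
    refine integral_mono (hint m).norm
      ((ha.integrable_of_hasCompactSupport hac).norm.mul_const _) fun x => ?_
    by_cases hx : a x = 0
    · simp [hx]
    · have := hM' x hx
      simp only [norm_mul, norm_div, norm_pow, mul_div_assoc]
      simp only [Real.norm_natCast]
      gcongr
  have key := hasSum_integral_of_summable_integral_norm hint hsum
  have h0 : ∀ m : ℕ, ∫ x, a x * c x ^ m / (m.factorial : ℝ) ∂μ = 0 := fun m => by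
    rw [integral_div, h, zero_div]
  simp only [h0] at key
  rw [← key.unique hasSum_zero]
  refine integral_congr_ae (Filter.Eventually.of_forall fun x => ?_)
  simp only [mul_div_assoc, tsum_mul_left, Real.exp_eq_exp_ℝ, NormedSpace.exp_eq_tsum_div]

end Analysis

/-! ### Injectivity of the Laplace transform, by Stone–Weierstrass. -/

section Laplace

variable {ι : Type*} [Fintype ι]

/-- The exponentials of linear forms, as a homomorphism from the additive group of linear forms. -/
noncomputable def expForm (ι : Type*) [Fintype ι] :
    Multiplicative (ι → ℝ) →* C(ι → ℝ, ℝ) where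
  toFun ξ := ⟨fun x => Real.exp (ξ.toAdd ⬝ᵥ x), by
    simp only [dotProduct]; fun_prop⟩
  map_one' := by ext x; simp
  map_mul' ξ η := by ext x; simp [add_dotProduct, Real.exp_add]

theorem expForm_apply (ξ : Multiplicative (ι → ℝ)) (x : ι → ℝ) :
    expForm ι ξ x = Real.exp (ξ.toAdd ⬝ᵥ x) := rfl

theorem separatesPoints_adjoin_expForm :
    (Algebra.adjoin ℝ (MonoidHom.mrange (expForm ι) : Set C(ι → ℝ, ℝ))).SeparatesPoints := by
  classical
  intro x y hxy
  obtain ⟨i, hi⟩ := Function.ne_iff.mp hxy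
  refine ⟨_, ⟨expForm ι (Multiplicative.ofAdd (Pi.single i 1)),
    Algebra.subset_adjoin ⟨_, rfl⟩, rfl⟩, ?_⟩
  simpa [expForm_apply] using hi

/-- A continuous function of compact support is determined by its Laplace transform. -/
theorem eq_zero_of_integral_mul_exp_eq_zero {f : (ι → ℝ) → ℝ} (hf : Continuous f)
    (hfc : HasCompactSupport f) (h : ∀ ξ : ι → ℝ, ∫ x, f x * Real.exp (ξ ⬝ᵥ x) = 0) :
    f = 0 := by
  have hA : ∀ g ∈ Algebra.adjoin ℝ (MonoidHom.mrange (expForm ι) : Set C(ι → ℝ, ℝ)),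
      ∫ x, f x * g x = 0 := by
    intro g hg
    -- The exponentials are closed under multiplication, so the algebra they generate is their
    -- linear span.
    rw [← Subalgebra.mem_toSubmodule, Algebra.adjoin_eq_span, Submonoid.closure_eq] at hg
    induction hg using Submodule.span_induction with
    | mem g hg =>
      obtain ⟨ξ, rfl⟩ := hg
      exact h ξ.toAdd
    | zero => simp
    | add g k _ _ hg hk =>
      simp only [ContinuousMap.add_apply, mul_add]
      rw [integral_add, hg, hk, add_zero]
      · exact (hf.mul g.continuous).integrable_of_hasCompactSupport hfc.mul_right
      · exact (hf.mul k.continuous).integrable_of_hasCompactSupport hfc.mul_right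
    | smul r g _ hg =>
      simp only [ContinuousMap.smul_apply, smul_eq_mul, mul_left_comm _ r]
      rw [integral_const_mul, hg, mul_zero]
  have hff : Integrable (fun x => f x * f x) :=
    (hf.mul hf).integrable_of_hasCompactSupport hfc.mul_right
  -- If g in the algebra is ε-close to f on the support of f, then ∫ f² = ∫ f (f - g), because ∫ f g
  -- = 0.
  have hle : ∀ ε > 0, ∫ x, f x * f x ≤ ε * ∫ x, ‖f x‖ := by
    intro ε hε
    obtain ⟨g, hg, hgf⟩ :=
      ContinuousMap.exists_mem_subalgebra_near_continuous_of_isCompact_of_separatesPoints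
        separatesPoints_adjoin_expForm ⟨f, hf⟩ hfc.isCompact hε
    have hfg : Integrable (fun x => f x * g x) :=
      (hf.mul g.continuous).integrable_of_hasCompactSupport hfc.mul_right
    rw [← sub_zero (∫ x, f x * f x), ← hA g hg, ← integral_sub hff hfg, ← integral_const_mul]
    refine integral_mono (hff.sub hfg)
      ((hf.integrable_of_hasCompactSupport hfc).norm.const_mul ε) fun x => ?_
    by_cases hx : f x = 0
    · simp [hx]
    · have h1 := (hgf x (subset_tsupport f hx)).le
      calc f x * f x - f x * g x = f x * (f x - g x) := by ring
        _ ≤ ‖f x * (f x - g x)‖ := le_abs_self _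
        _ = ‖g x - f x‖ * ‖f x‖ := by rw [norm_mul, mul_comm, norm_sub_rev]
        _ ≤ ε * ‖f x‖ := by gcongr; exact h1
  have hnn : 0 ≤ ∫ x, ‖f x‖ := integral_nonneg fun x => norm_nonneg _
  have h0 : ∫ x, f x * f x = 0 := by
    refine le_antisymm (le_of_forall_pos_le_add fun ε hε => ?_)
      (integral_nonneg fun x => mul_self_nonneg _)
    refine (hle (ε / ((∫ x, ‖f x‖) + 1)) (by positivity)).trans ?_
    rw [zero_add, div_mul_eq_mul_div, div_le_iff₀ (by positivity)]
    nlinarith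
  rw [integral_eq_zero_iff_of_nonneg (fun x => mul_self_nonneg _) hff] at h0
  have h1 := Continuous.ae_eq_iff_eq volume (hf.mul hf) continuous_zero |>.mp h0
  funext x
  exact mul_self_eq_zero.mp (congrFun h1 x)

end Laplace

namespace FieldTheory

/-! ### Divergence of a vector field from its fluxes. -/

section VectorField

variable {n : ℕ}

theorem differentiableAt_fderiv_exp_dotProduct (ξ x : Spacetime n) (ν : Fin (n + 1)) :
    DifferentiableAt ℝ (fun y : Spacetime n => Real.exp (ξ ⬝ᵥ y)) x ∧
    fderiv ℝ (fun y : Spacetime n => Real.exp (ξ ⬝ᵥ y)) x (Pi.single ν 1) =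
      ξ ν * Real.exp (ξ ⬝ᵥ x) := by
  have h : HasFDerivAt (fun y : Spacetime n => ξ ⬝ᵥ y)
      (LinearMap.toContinuousLinearMap (dotProductBilin ℝ ℝ ξ)) x :=
    (LinearMap.toContinuousLinearMap (dotProductBilin ℝ ℝ ξ)).hasFDerivAt
  refine ⟨h.exp.differentiableAt, ?_⟩
  rw [h.exp.fderiv]
  simp [mul_comm]

/-- A smooth vector field of compact support is free of divergence if the Laplace transform of its
longitudinal component vanishes. -/
theorem divergence_eq_zero_of_integral_mul_exp {J : Spacetime n → Fin (n + 1) → ℝ}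
    (hJ : ContDiff ℝ ∞ J) (hJc : HasCompactSupport J)
    (h : ∀ ξ : Spacetime n, ∫ x, (ξ ⬝ᵥ J x) * Real.exp (ξ ⬝ᵥ x) = 0) (x : Spacetime n) :
    ∑ μ, fderiv ℝ (fun y => J y μ) x (Pi.single μ 1) = 0 := by
  have hJμ : ∀ μ, ContDiff ℝ ∞ fun y => J y μ := fun μ => contDiff_pi.mp hJ μ
  have hcμ : ∀ μ, HasCompactSupport fun y => J y μ := fun μ =>
    hJc.comp_left (g := fun v : Fin (n + 1) → ℝ => v μ) rfl
  have hD : ∀ μ, Continuous fun y => fderiv ℝ (fun y => J y μ) y (Pi.single μ 1) := fun μ =>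
    ((hJμ μ).continuous_fderiv (by simp)).clm_apply continuous_const
  have hDc : ∀ μ, HasCompactSupport fun y => fderiv ℝ (fun y => J y μ) y (Pi.single μ 1) :=
    fun μ => ((hcμ μ).fderiv (𝕜 := ℝ)).comp_left
      (g := fun v : Spacetime n →L[ℝ] ℝ => v (Pi.single μ 1)) rfl
  have hE : ∀ ξ : Spacetime n, Continuous fun x => Real.exp (ξ ⬝ᵥ x) := fun ξ => by
    simp only [dotProduct]; fun_prop
  refine congrFun (eq_zero_of_integral_mul_exp_eq_zero
    (f := fun x => ∑ μ, fderiv ℝ (fun y => J y μ) x (Pi.single μ 1))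
    (continuous_finsetSum _ fun μ _ => hD μ) ?_ fun ξ => ?_) x
  · refine HasCompactSupport.of_support_subset_isCompact hJc.isCompact
      fun x hx => ?_
    by_contra hxJ
    refine hx (Finset.sum_eq_zero fun μ _ => ?_)
    have e : (fun y => J y μ) =ᶠ[nhds x] fun _ => 0 :=
      (notMem_tsupport_iff_eventuallyEq.mp hxJ).mono fun y hy => by simp [hy]
    simp [e.fderiv_eq]
  · have hi : ∀ μ, Integrable fun x =>
        fderiv ℝ (fun y => J y μ) x (Pi.single μ 1) * Real.exp (ξ ⬝ᵥ x) := fun μ =>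
      ((hD μ).mul (hE ξ)).integrable_of_hasCompactSupport (hDc μ).mul_right
    have hi' : ∀ μ, Integrable fun x => J x μ * (ξ μ * Real.exp (ξ ⬝ᵥ x)) := fun μ =>
      ((hJμ μ).continuous.mul (continuous_const.mul (hE ξ))).integrable_of_hasCompactSupport
        (hcμ μ).mul_right
    -- Summed over μ, this says that the Laplace transform of div J is minus that of ξ·J.
    have hparts : ∀ μ, ∫ x, fderiv ℝ (fun y => J y μ) x (Pi.single μ 1) * Real.exp (ξ ⬝ᵥ x) =
        -∫ x, J x μ * (ξ μ * Real.exp (ξ ⬝ᵥ x)) := fun μ => by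
      have := integral_mul_fderiv_eq_neg_fderiv_mul_of_integrable (μ := (volume : Measure (Spacetime n)))
        (f := fun y => J y μ) (g := fun x : Spacetime n => Real.exp (ξ ⬝ᵥ x))
        (v := Pi.single μ 1) (hi μ)
        (by simpa only [(differentiableAt_fderiv_exp_dotProduct ξ _ μ).2] using hi' μ)
        (((hJμ μ).continuous.mul (hE ξ)).integrable_of_hasCompactSupport (hcμ μ).mul_right)
        (fun x _ => (hJμ μ).differentiable (by simp) x)
        (fun x _ => (differentiableAt_fderiv_exp_dotProduct ξ x μ).1)
      simp only [(differentiableAt_fderiv_exp_dotProduct ξ _ μ).2] at this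
      rw [this, neg_neg]
    simp only [Finset.sum_mul]
    rw [integral_finsetSum _ fun μ _ => hi μ]
    simp only [hparts, Finset.sum_neg_distrib]
    rw [← integral_finsetSum _ fun μ _ => hi' μ, neg_eq_zero, ← h ξ]
    refine integral_congr_ae (Filter.Eventually.of_forall fun x => ?_)
    simp only [dotProduct, Finset.sum_mul]
    exact Finset.sum_congr rfl fun μ _ => by ring

/-- A covector is future timelike. -/
def IsFutureTimelike (ξ : Spacetime n) : Prop := 0 < ξ 0 ∧ 0 < minkowski ξ ξ

/-- A smooth vector field of compact support is free of divergence if the moments of its flux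
through the spacelike hyperplanes vanish. -/
theorem divergence_eq_zero_of_moments {J : Spacetime n → Fin (n + 1) → ℝ}
    (hJ : ContDiff ℝ ∞ J) (hJc : HasCompactSupport J)
    (h : ∀ ξ : Spacetime n, IsFutureTimelike ξ → ∀ m : ℕ, ∫ x, (ξ ⬝ᵥ J x) * (ξ ⬝ᵥ x) ^ m = 0)
    (x : Spacetime n) : ∑ μ, fderiv ℝ (fun y => J y μ) x (Pi.single μ 1) = 0 := by
  have hJd : ∀ ξ : Spacetime n, Continuous fun x => ξ ⬝ᵥ J x := fun ξ =>
    continuous_const.dotProduct hJ.continuous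
  have hJdc : ∀ ξ : Spacetime n, HasCompactSupport fun x => ξ ⬝ᵥ J x := fun ξ =>
    hJc.comp_left (g := fun v : Fin (n + 1) → ℝ => ξ ⬝ᵥ v) (by simp)
  have hid : ∀ ξ : Spacetime n, Continuous fun x : Spacetime n => ξ ⬝ᵥ x := fun ξ =>
    continuous_const.dotProduct continuous_id
  refine divergence_eq_zero_of_integral_mul_exp hJ hJc (fun ξ => ?_) x
  refine integral_mul_exp_eq_zero (hJd ξ) (hJdc ξ) (hid ξ) fun m => ?_
  -- The line e + s η starts inside the open timelike cone and reaches the arbitrary ξ at s = 1. The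
  -- moment is polynomial in s and vanishes for s near 0, hence also at s = 1.
  set e : Spacetime n := Pi.single 0 1
  set η : Spacetime n := ξ - e
  obtain ⟨P, hP⟩ := exists_polynomial_integral_mul_pow (μ := (volume : Measure (Spacetime n)))
    (hid e) (hid η) m (hJd e) (hJdc e)
  obtain ⟨R, hR⟩ := exists_polynomial_integral_mul_pow (μ := (volume : Measure (Spacetime n)))
    (hid e) (hid η) m (hJd η) (hJdc η)
  have hcurve : ∀ s : ℝ, ∫ x, ((e + s • η) ⬝ᵥ J x) * ((e + s • η) ⬝ᵥ x) ^ m =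
      (P + Polynomial.X * R).eval s := by
    intro s
    have hcd : Continuous fun x : Spacetime n => (e ⬝ᵥ x + s * η ⬝ᵥ x) ^ m :=
      ((hid e).add (continuous_const.mul (hid η))).pow m
    rw [Polynomial.eval_add, Polynomial.eval_mul, Polynomial.eval_X, ← hP, ← hR,
      ← integral_const_mul, ← integral_add]
    · refine integral_congr_ae (Filter.Eventually.of_forall fun x => ?_)
      simp only [add_dotProduct, smul_dotProduct, smul_eq_mul]
      ring
    · exact ((hJd e).mul hcd).integrable_of_hasCompactSupport (hJdc e).mul_right
    · exact (((hJd η).mul hcd).integrable_of_hasCompactSupport (hJdc η).mul_right).const_mul s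
  have hfut : ∀ᶠ s : ℝ in nhds 0, IsFutureTimelike (e + s • η) := by
    have h0 : Continuous fun s : ℝ => (e + s • η) 0 := by fun_prop
    have h1 : Continuous fun s : ℝ => minkowski (e + s • η) (e + s • η) := by
      unfold minkowski; fun_prop
    exact ((h0.tendsto 0).eventually_const_lt (by simp [e])).and
      ((h1.tendsto 0).eventually_const_lt (by simp [e, minkowski]))
  have hzero : P + Polynomial.X * R = 0 := by
    refine Polynomial.eq_zero_of_infinite_isRoot _ (infinite_of_mem_nhds (0 : ℝ) ?_)
    filter_upwards [hfut] with s hs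
    exact (hcurve s).symm.trans (h _ hs m)
  have := hcurve 1
  rw [hzero] at this
  simpa [η] using this

end VectorField

/-! ### Construction of boosts from reflections. -/

section Lorentz

variable {n : ℕ}

theorem minkowski_comm (x y : Spacetime n) : minkowski x y = minkowski y x := by
  simp [minkowski, mul_comm]

/-- The Minkowski product with a vector, as a linear form. -/
noncomputable def minkowskiForm (w : Spacetime n) : Spacetime n →ₗ[ℝ] ℝ where
  toFun x := minkowski w x
  map_add' x y := by
    simp only [minkowski, Pi.add_apply, mul_add, Finset.sum_add_distrib]; ring
  map_smul' c x := by
    simp only [minkowski, Pi.smul_apply, smul_eq_mul, RingHom.id_apply, mul_sub, Finset.mul_sum]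
    congr 1
    · ring
    · exact Finset.sum_congr rfl fun i _ => by ring

theorem minkowskiForm_apply (w x : Spacetime n) : minkowskiForm w x = minkowski w x := rfl

/-- The reflection in the hyperplane orthogonal to `w`. -/
noncomputable def minkowskiReflection (w : Spacetime n) : Spacetime n →ₗ[ℝ] Spacetime n :=
  LinearMap.transvection (minkowskiForm w) (-(2 / minkowski w w) • w)

theorem minkowskiReflection_apply (w x : Spacetime n) :
    minkowskiReflection w x = x - (2 * minkowski w x / minkowski w w) • w := by
  simp only [minkowskiReflection, LinearMap.transvection.apply, minkowskiForm_apply, smul_smul,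
    sub_eq_add_neg, ← neg_smul]
  congr 2
  ring

theorem det_minkowskiReflection {w : Spacetime n} (hw : minkowski w w ≠ 0) :
    LinearMap.det (minkowskiReflection w) = -1 := by
  rw [minkowskiReflection, LinearMap.transvection.det, map_smul, minkowskiForm_apply]
  simp only [smul_eq_mul, neg_mul, div_mul_cancel₀ _ hw]
  norm_num

theorem minkowski_minkowskiReflection {w : Spacetime n} (hw : minkowski w w ≠ 0)
    (x y : Spacetime n) :
    minkowski (minkowskiReflection w x) (minkowskiReflection w y) = minkowski x y := by
  have h1 : ∀ (u v : Spacetime n) (c : ℝ), minkowski u (v - c • w) =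
      minkowski u v - c * minkowski u w := fun u v c => by
    simp only [← minkowskiForm_apply, map_sub, map_smul, smul_eq_mul]
  have h2 : ∀ (u v : Spacetime n) (c : ℝ), minkowski (v - c • w) u =
      minkowski v u - c * minkowski w u := fun u v c => by
    rw [minkowski_comm, h1, minkowski_comm v, minkowski_comm w]
  rw [minkowskiReflection_apply, minkowskiReflection_apply, h1, h2, h2, minkowski_comm x w]
  field_simp
  ring

/-- Every future timelike covector is proportional to the time component of a restricted Lorentz
transformation. -/
theorem exists_restrictedLorentz_of_isFutureTimelike {ξ : Spacetime n} (hξ : IsFutureTimelike ξ) :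
    ∃ A : Spacetime n ≃L[ℝ] Spacetime n, IsRestrictedLorentz A ∧
      ∃ r : ℝ, ∀ x, ξ ⬝ᵥ x = r * A x 0 := by
  obtain ⟨h0, hq⟩ := hξ
  set N := Real.sqrt (minkowski ξ ξ)
  have hN : 0 < N := Real.sqrt_pos.mpr hq
  have hNN : N * N = minkowski ξ ξ := Real.mul_self_sqrt hq.le
  set e : Spacetime n := Pi.single 0 1
  -- N e and -ξ have equal Minkowski square and differ by w, so the reflection in w exchanges them.
  -- Reflecting first in e converts the Minkowski product with -ξ into the Euclidean pairing ξ·x.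
  -- The two reflections together have determinant 1.
  set w : Spacetime n := N • e + ξ
  have hee : minkowski e e = 1 := by simp [minkowski, e]
  have he : ∀ x, minkowski e x = x 0 := fun x => by simp [minkowski, e]
  have hwx : ∀ x, minkowski w x = N * x 0 + minkowski ξ x := fun x => by
    rw [minkowski_comm, ← minkowskiForm_apply, map_add, map_smul, minkowskiForm_apply,
      minkowskiForm_apply, minkowski_comm x e, he, minkowski_comm x ξ, smul_eq_mul]
  have hw0 : w 0 = N + ξ 0 := by simp [w, e]
  have hww : minkowski w w = 2 * N * w 0 := by
    rw [hwx, minkowski_comm, hwx, ← hNN, hw0]; ring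
  have hww0 : minkowski w w ≠ 0 := by
    rw [hww, hw0]; positivity
  set B := minkowskiReflection w ∘ₗ minkowskiReflection e
  have hdet : LinearMap.det B = 1 := by
    rw [LinearMap.det_comp, det_minkowskiReflection hww0,
      det_minkowskiReflection (by rw [hee]; exact one_ne_zero)]
    norm_num
  have hBm : ∀ x y, minkowski (B x) (B y) = minkowski x y := fun x y => by
    simp only [B, LinearMap.comp_apply]
    rw [minkowski_minkowskiReflection hww0,
      minkowski_minkowskiReflection (by rw [hee]; exact one_ne_zero)]
  have hB0 : ∀ x, ξ ⬝ᵥ x = N * B x 0 := fun x => by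
    have hr : minkowskiReflection e x = x - (2 * x 0) • e := by
      rw [minkowskiReflection_apply, he, hee, div_one]
    have hξr : minkowski ξ (minkowskiReflection e x) = -(ξ ⬝ᵥ x) := by
      rw [hr, ← minkowskiForm_apply, map_sub, map_smul, minkowskiForm_apply, minkowskiForm_apply,
        minkowski_comm ξ e, he]
      simp only [minkowski, dotProduct, Fin.sum_univ_succ, smul_eq_mul]
      ring
    have hr0 : minkowskiReflection e x 0 = -x 0 := by
      rw [hr]; simp [e]; ring
    simp only [B, LinearMap.comp_apply]
    rw [minkowskiReflection_apply w, Pi.sub_apply, Pi.smul_apply, hwx, hξr, hr0, hww]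
    have : w 0 ≠ 0 := by rw [hw0]; positivity
    simp only [smul_eq_mul]
    field_simp
    ring
  let A : Spacetime n ≃L[ℝ] Spacetime n := (LinearEquiv.ofIsUnitDet (f := B)
    (v := Pi.basisFun ℝ (Fin (n + 1))) (v' := Pi.basisFun ℝ (Fin (n + 1)))
    (by rw [LinearMap.det_toMatrix, hdet]; exact isUnit_one)).toContinuousLinearEquiv
  have hAB : ∀ x, A x = B x := fun x => rfl
  refine ⟨A, ⟨fun x y => ?_, ?_, ?_⟩, N, fun x => by rw [hAB, hB0]⟩
  · rw [hAB, hAB, hBm]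
  · rw [← hdet]; congr 1
  · have h := hB0 e
    rw [show ξ ⬝ᵥ e = ξ 0 by simp [e]] at h
    rw [hAB]
    exact pos_of_mul_pos_right (h ▸ h0) hN.le

end Lorentz

/-! ### Locality of currents, and functionals with vanishing derivative. -/

section Fields

variable {n : ℕ} {κ G : Type*} [Fintype κ] [NormedRing G] [NormedAlgebra ℝ G]

theorem contDiff_event (t : ℝ) : ContDiff ℝ ∞ (event t : Space n → Spacetime n) := by
  refine contDiff_pi.mpr fun i => ?_
  cases i using Fin.cases with
  | zero => simpa [event] using contDiff_const
  | succ i => simpa [event] using contDiff_apply ℝ ℝ i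

theorem hasCompactSupport_comp_event {M : Type*} [Zero M] {f : Spacetime n → M}
    (hf : HasCompactSupport f) (t : ℝ) : HasCompactSupport fun x : Space n => f (event t x) := by
  have hK : IsCompact ((fun (y : Spacetime n) (i : Fin n) => y i.succ) '' tsupport f) :=
    hf.isCompact.image (by fun_prop)
  refine HasCompactSupport.of_support_subset_isCompact hK fun x hx =>
    ⟨event t x, subset_tsupport f hx, ?_⟩
  funext i
  simp [event]

theorem LocalCurrent.contDiff_eval (j : LocalCurrent n κ G) {Φ : Spacetime n → κ → G}
    (hΦ : ContDiff ℝ ∞ Φ) : ContDiff ℝ ∞ (j.eval Φ) :=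
  j.smooth.comp (contDiff_id.prodMk (contDiff_pi.mpr fun i =>
    hΦ.iteratedFDeriv_right (by exact_mod_cast le_top)))

theorem LocalCurrent.eval_congr (j : LocalCurrent n κ G) {Φ Ψ : Spacetime n → κ → G}
    {x : Spacetime n} (h : Φ =ᶠ[nhds x] Ψ) : j.eval Φ x = j.eval Ψ x := by
  funext μ
  have : ∀ i : ℕ, iteratedFDeriv ℝ i Φ x = iteratedFDeriv ℝ i Ψ x := fun i =>
    (h.iteratedFDeriv ℝ i).eq_of_nhds
  simp only [LocalCurrent.eval, this]

theorem LocalCurrent.divergence_congr (j : LocalCurrent n κ G) {Φ Ψ : Spacetime n → κ → G}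
    {x : Spacetime n} (h : Φ =ᶠ[nhds x] Ψ) : j.divergence Φ x = j.divergence Ψ x := by
  refine Finset.sum_congr rfl fun μ _ => ?_
  have : (fun y => j.eval Φ y μ) =ᶠ[nhds x] fun y => j.eval Ψ y μ :=
    h.eventually_nhds.mono fun y hy => congrFun (j.eval_congr hy) μ
  rw [this.fderiv_eq]

variable {𝒢 : ZMod 2 → Submodule ℝ G} {p : κ → ZMod 2}

theorem isField_const {E : Type*} [NormedAddCommGroup E] [NormedSpace ℝ E] {v : κ → G}
    (hv : HasParity 𝒢 p v) : IsField 𝒢 p fun _ : E => v :=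
  ⟨contDiff_const, fun _ => hv⟩

/-- Difference quotients lie in the homogeneous subspace, which is closed because it is
finite-dimensional. -/
theorem IsField.hasParity_fderiv [FiniteDimensional ℝ G] {E : Type*} [NormedAddCommGroup E]
    [NormedSpace ℝ E] {Φ : E → κ → G} (hΦ : IsField 𝒢 p Φ) (x u : E) :
    HasParity 𝒢 p (fderiv ℝ Φ x u) := by
  intro a
  have h : HasLineDerivAt ℝ Φ (fderiv ℝ Φ x u) x u :=
    ((hΦ.1.differentiable (by simp) x).hasFDerivAt).hasLineDerivAt u
  have h1 := hasDerivAt_pi.mp (show HasDerivAt (fun s : ℝ => Φ (x + s • u)) _ 0 from h) a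
  refine (𝒢 (p a)).closed_of_finiteDimensional.mem_of_tendsto
    (hasDerivAt_iff_tendsto_slope.mp h1) (Filter.Eventually.of_forall fun s => ?_)
  rw [slope_def_module]
  exact (𝒢 (p a)).smul_mem _ ((𝒢 (p a)).sub_mem (hΦ.2 _ a) (hΦ.2 _ a))

variable [DecidableEq κ]

/-- A functional on the fields that agree with `φ₀` outside a compact set is constant if its
functional derivative vanishes. -/
theorem functional_eq_of_hasDerivAt_zero {F : (Space n → κ → G) → G} {φ₀ : Space n → κ → G}
    (h₀ : IsField 𝒢 p φ₀)
    (hF : ∀ φ, IsField 𝒢 p φ → HasCompactSupport (fun x => φ x - φ₀ x) →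
      ∀ a h, IsVariation 𝒢 (p a) h →
        HasDerivAt (fun s : ℝ => F (fun y => φ y + s • (Pi.single a (h y) : κ → G))) 0 0)
    {φ : Space n → κ → G} (hφ : IsField 𝒢 p φ) (hφc : HasCompactSupport fun x => φ x - φ₀ x) :
    F φ = F φ₀ := by
  have hsingle : ∀ a, ∀ h : Space n → G, IsVariation 𝒢 (p a) h →
      IsField 𝒢 p (fun y => (Pi.single a (h y) : κ → G)) ∧
      HasCompactSupport (fun y => (Pi.single a (h y) : κ → G)) := by
    refine fun a h hh => ⟨⟨contDiff_pi.mpr fun b => ?_, fun y b => ?_⟩,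
      hh.2.1.comp_left (g := fun v => (Pi.single a v : κ → G)) (Pi.single_zero a)⟩
    · by_cases hb : b = a
      · subst hb; simpa using hh.1
      · simpa [hb] using contDiff_const
    · by_cases hb : b = a
      · subst hb; simpa using hh.2.2 y
      · simp [hb]
  have hline : ∀ φ, IsField 𝒢 p φ → HasCompactSupport (fun x => φ x - φ₀ x) →
      ∀ a h, IsVariation 𝒢 (p a) h →
        F (fun y => φ y + (Pi.single a (h y) : κ → G)) = F φ := by
    intro φ hφ hφc a h hh
    obtain ⟨⟨hs1, hs2⟩, hs3⟩ := hsingle a h hh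
    -- The hypothesis gives derivatives only at 0; the derivative at τ is the one at 0 from the
    -- shifted base point, which is still admissible.
    have hder : ∀ τ : ℝ,
        HasDerivAt (fun s : ℝ => F (fun y => φ y + s • (Pi.single a (h y) : κ → G))) 0 τ := by
      intro τ
      have h1 := hF (fun y => φ y + τ • (Pi.single a (h y) : κ → G))
        ⟨hφ.1.add (hs1.const_smul τ), fun y b =>
          (𝒢 (p b)).add_mem (hφ.2 y b) ((𝒢 (p b)).smul_mem τ (hs2 y b))⟩
        (by
          have h2 := hφc.add (hs3.comp_left (g := fun v => τ • v) (smul_zero τ))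
          refine h2.mono fun y hy => ?_
          simpa [add_sub_right_comm] using hy) a h hh
      rw [← sub_self τ] at h1
      have h3 := h1.comp_sub_const τ τ
      refine h3.congr_of_eventuallyEq (Filter.Eventually.of_forall fun s => ?_)
      simp only [add_assoc, ← add_smul, add_sub_cancel]
    have := is_const_of_deriv_eq_zero (fun τ => (hder τ).differentiableAt)
      (fun τ => (hder τ).deriv) 1 0
    simpa using this
  -- A variation touches a single component, so the components are replaced one by one.
  have key : ∀ s : Finset κ, F (fun y a => if a ∈ s then φ₀ y a else φ y a) = F φ := by
    intro s
    induction s using Finset.induction_on with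
    | empty => simp
    | insert a s ha ih =>
      rw [← ih]
      have hψ : IsField 𝒢 p fun y b => if b ∈ s then φ₀ y b else φ y b := by
        refine ⟨contDiff_pi.mpr fun b => ?_, fun y b => ?_⟩ <;> by_cases hb : b ∈ s <;>
          simp only [hb, if_true, if_false]
        exacts [contDiff_pi.mp h₀.1 b, contDiff_pi.mp hφ.1 b, h₀.2 y b, hφ.2 y b]
      have hψc : HasCompactSupport fun y => (fun b => if b ∈ s then φ₀ y b else φ y b) - φ₀ y := by
        refine hφc.mono fun y hy hy0 => hy ?_
        funext b
        have := congrFun hy0 b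
        by_cases hb : b ∈ s <;> simp_all
      have hh : IsVariation 𝒢 (p a) fun y => φ₀ y a - φ y a := by
        refine ⟨(contDiff_pi.mp h₀.1 a).sub (contDiff_pi.mp hφ.1 a), ?_,
          fun y => (𝒢 (p a)).sub_mem (h₀.2 y a) (hφ.2 y a)⟩
        refine hφc.mono fun y hy hy0 => hy ?_
        have : φ y a - φ₀ y a = 0 := congrFun hy0 a
        exact sub_eq_zero.mpr (sub_eq_zero.mp this).symm
      rw [← hline _ hψ hψc a _ hh]
      congr 1
      funext y b
      by_cases hb : b = a
      · subst hb; simp [ha]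
      · simp [hb]
  simpa using (key Finset.univ).symm

end Fields

/-! ### Fubini over time slices, and Lorentz invariance of the volume. -/

section Moments

variable {n : ℕ}

theorem integral_eq_zero_of_integral_event_eq_zero {F : Spacetime n → ℝ} (hF : Integrable F)
    (h : ∀ t, ∫ x : Space n, F (event t x) = 0) : ∫ x, F x = 0 := by
  have e := (volume_preserving_piFinSuccAbove (fun _ : Fin (n + 1) => ℝ) 0).symm
  rw [← e.integral_comp' F]
  have hF' : Integrable (fun z => F ((MeasurableEquiv.piFinSuccAbove
      (fun _ : Fin (n + 1) => ℝ) 0).symm z)) (volume.prod volume) :=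
    (e.integrable_comp_emb (MeasurableEquiv.measurableEmbedding _)).mpr hF
  refine (integral_prod _ hF').trans ?_
  refine integral_eq_zero_of_ae (Filter.Eventually.of_forall fun t => ?_)
  refine Eq.trans ?_ (h t)
  refine integral_congr_ae (Filter.Eventually.of_forall fun x => ?_)
  simp [MeasurableEquiv.piFinSuccAbove, event, Fin.consEquiv]

theorem integral_comp_lorentz {A : Spacetime n ≃L[ℝ] Spacetime n} (hA : IsRestrictedLorentz A)
    (F : Spacetime n → ℝ) : ∫ x, F (A x) = ∫ x, F x := by
  have h1 := Measure.map_linearMap_addHaar_eq_smul_addHaar (volume : Measure (Spacetime n))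
    (f := ((A : Spacetime n →L[ℝ] Spacetime n) : Spacetime n →ₗ[ℝ] Spacetime n))
    (by rw [hA.2.1]; exact one_ne_zero)
  rw [hA.2.1] at h1
  have h2 : MeasurePreserving A.toHomeomorph.toMeasurableEquiv :=
    ⟨A.toHomeomorph.toMeasurableEquiv.measurable, by simpa using h1⟩
  exact h2.integral_comp' F

end Moments

/-! ### From the canonical charge to the divergence of the current. -/

namespace RelativisticFieldTheory

variable {n : ℕ} {κ : Type*} [Fintype κ] [DecidableEq κ]
  {G : Type*} [NormedRing G] [NormedAlgebra ℝ G] {𝒢 : ZMod 2 → Submodule ℝ G}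
  {S : Type*} [Group S] (T : RelativisticFieldTheory n κ 𝒢 S)

theorem isHistory_vacuum : T.IsHistory fun _ => T.vacuum :=
  ⟨isField_const T.vacuum_parity, by
    simp only [sub_self]
    exact HasCompactSupport.zero⟩

theorem isField_fieldAt (t : ℝ) {Φ : Spacetime n → κ → G} (hΦ : IsField 𝒢 T.parity Φ) :
    IsField 𝒢 T.parity (T.fieldAt t Φ) :=
  ⟨hΦ.1.comp (contDiff_event t), fun _ => hΦ.2 _⟩

theorem isField_momentumAt [FiniteDimensional ℝ G] (t : ℝ) {Φ : Spacetime n → κ → G}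
    (hΦ : IsField 𝒢 T.parity Φ) : IsField 𝒢 T.parity (T.momentumAt t Φ) := by
  refine ⟨?_, fun x => (T.momentum_spec.2 _ _ _ (hΦ.2 _) (hΦ.hasParity_fderiv _)).1⟩
  have h1 : ContDiff ℝ ∞ (fderiv ℝ Φ) := hΦ.1.fderiv_right (by exact_mod_cast le_top)
  exact T.momentum_spec.1.comp ((contDiff_event t).prodMk
    ((hΦ.1.comp (contDiff_event t)).prodMk (h1.comp (contDiff_event t))))

/-- The canonical variables of a history form a point of phase space. -/
theorem isPhasePoint [FiniteDimensional ℝ G] (t : ℝ) {Φ : Spacetime n → κ → G}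
    (hΦ : T.IsHistory Φ) : T.IsPhasePoint t (T.fieldAt t Φ) (T.momentumAt t Φ) := by
  refine ⟨T.isField_fieldAt t hΦ.1, T.isField_momentumAt t hΦ.1,
    hasCompactSupport_comp_event hΦ.2 t, ?_⟩
  have h : HasCompactSupport fun x : Spacetime n => T.momentum x (Φ x) (fderiv ℝ Φ x) -
      T.momentum x T.vacuum (fderiv ℝ (fun _ => T.vacuum) x) := by
    refine HasCompactSupport.of_support_subset_isCompact hΦ.2.isCompact fun x hx => ?_
    by_contra hxΦ
    have e : Φ =ᶠ[nhds x] fun _ => T.vacuum :=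
      (notMem_tsupport_iff_eventuallyEq.mp hxΦ).mono fun y hy => sub_eq_zero.mp hy
    exact hx (by simp [e.fderiv_eq, e.eq_of_nhds])
  exact hasCompactSupport_comp_event h t

/-- A functional that generates no transformation is constant on phase space. -/
theorem functional_eq_vacuum [FiniteDimensional ℝ G] {t : ℝ}
    {F : (Space n → κ → G) → (Space n → κ → G) → G}
    (hφ : ∀ φ π, T.IsPhasePoint t φ π → ∀ a, HasBracketWithField 𝒢 T.parity F φ π a 0)
    (hπ : ∀ φ π, T.IsPhasePoint t φ π → ∀ a, HasBracketWithMomentum 𝒢 T.parity F φ π a 0)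
    {φ π : Space n → κ → G} (h : T.IsPhasePoint t φ π) :
    F φ π = F (fun _ => T.vacuum) (T.momentumAt t fun _ => T.vacuum) := by
  have hv := T.isPhasePoint t T.isHistory_vacuum
  -- The conditions on φ and on π are independent, so the mixed pairs stay in phase space.
  have h1 : F φ π = F (fun _ => T.vacuum) π :=
    functional_eq_of_hasDerivAt_zero (F := fun φ => F φ π) hv.1
      (fun ψ hψ hψc a k hk => by
        simpa using hπ ψ π ⟨hψ, h.2.1, hψc, h.2.2.2⟩ a k hk) h.1 h.2.2.1
  rw [h1]
  exact functional_eq_of_hasDerivAt_zero (F := fun π => F (fun _ => T.vacuum) π) hv.2.1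
      (fun ψ hψ hψc a k hk => by
        simpa using hφ (fun _ => T.vacuum) ψ ⟨hv.1, hψ, hv.2.2.1, hψc⟩ a k hk) h.2.1 h.2.2.2

/-- The difference between a current and its vacuum value. -/
noncomputable def excess (j : LocalCurrent n κ G) (Φ : Spacetime n → κ → G) (x : Spacetime n) :
    Fin (n + 1) → G :=
  j.eval Φ x - j.eval (fun _ => T.vacuum) x

variable {T} {j : LocalCurrent n κ G}

theorem contDiff_excess {Φ : Spacetime n → κ → G} (hΦ : T.IsHistory Φ) :
    ContDiff ℝ ∞ (T.excess j Φ) :=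
  (j.contDiff_eval hΦ.1.1).sub (j.contDiff_eval contDiff_const)

theorem hasCompactSupport_excess {Φ : Spacetime n → κ → G} (hΦ : T.IsHistory Φ) :
    HasCompactSupport (T.excess j Φ) := by
  refine HasCompactSupport.of_support_subset_isCompact hΦ.2.isCompact fun x hx => ?_
  by_contra hxΦ
  have e : Φ =ᶠ[nhds x] fun _ => T.vacuum :=
    (notMem_tsupport_iff_eventuallyEq.mp hxΦ).mono fun y hy => sub_eq_zero.mp hy
  exact hx (sub_eq_zero.mpr (j.eval_congr e))

/-- The charge of every history is that of the vacuum. -/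
theorem integral_excess_eq_zero [FiniteDimensional ℝ G]
    {Q : ℝ → (Space n → κ → G) → (Space n → κ → G) → G} (hQ : T.IsCanonicalCharge j Q)
    (hφ : ∀ t φ π, T.IsPhasePoint t φ π → ∀ a, HasBracketWithField 𝒢 T.parity (Q t) φ π a 0)
    (hπ : ∀ t φ π, T.IsPhasePoint t φ π → ∀ a, HasBracketWithMomentum 𝒢 T.parity (Q t) φ π a 0)
    {Φ : Spacetime n → κ → G} (hΦ : T.IsHistory Φ) (t : ℝ) :
    ∫ x : Space n, T.excess j Φ (event t x) 0 = 0 := by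
  have h1 := hQ t Φ hΦ
  have h2 := hQ t _ T.isHistory_vacuum
  simp only [excess, Pi.sub_apply]
  rw [integral_sub h1.1 h2.1, sub_eq_zero]
  refine h1.2.trans (Eq.trans ?_ h2.2.symm)
  exact T.functional_eq_vacuum (hφ t) (hπ t) (T.isPhasePoint t hΦ)

theorem poincareAct_vacuum (s : S) (b : Spacetime n) :
    poincareAct (T.lorentz s) (T.rep s) b (fun _ => T.vacuum) = fun _ => T.vacuum :=
  funext fun _ => T.vacuum_invariant s

theorem IsHistory.poincareAct {Φ : Spacetime n → κ → G} (hΦ : T.IsHistory Φ) (s : S)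
    (b : Spacetime n) : T.IsHistory (poincareAct (T.lorentz s) (T.rep s) b Φ) := by
  refine ⟨⟨(T.rep s).contDiff.comp (hΦ.1.1.comp ((T.lorentz s).symm.contDiff.comp
    (contDiff_id.sub contDiff_const))), fun x => T.rep_parity s _ (hΦ.1.2 _)⟩, ?_⟩
  have h1 := (hΦ.2.comp_homeomorph
    ((Homeomorph.subRight b).trans (T.lorentz s).symm.toHomeomorph)).comp_left
    (map_zero (T.rep s))
  refine h1.mono fun x hx => ?_
  have e : T.rep s (Φ ((T.lorentz s).symm (x - b)) - T.vacuum) =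
      FieldTheory.poincareAct (T.lorentz s) (T.rep s) b Φ x - T.vacuum := by
    rw [map_sub, T.vacuum_invariant]; rfl
  exact fun h0 => hx (e.symm.trans h0)

/-- The vacuum is Poincaré invariant, so its current obeys the same law and can be subtracted. -/
theorem excess_poincareAct (hj : T.IsFourVector j) {Φ : Spacetime n → κ → G}
    (hΦ : T.IsHistory Φ) (s : S) (x : Spacetime n) (μ : Fin (n + 1)) :
    T.excess j (poincareAct (T.lorentz s) (T.rep s) 0 Φ) (T.lorentz s x) μ =
      ∑ ν, (T.lorentz s (Pi.single ν 1) μ) • T.excess j Φ x ν := by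
  have h1 := hj s 0 Φ hΦ.1 x μ
  have h2 := hj s 0 _ T.isHistory_vacuum.1 x μ
  rw [poincareAct_vacuum] at h2
  rw [add_zero] at h1 h2
  simp only [excess, Pi.sub_apply, smul_sub, Finset.sum_sub_distrib, h1, h2]

/-- Translation covariance; this is why passing to the excess does not change the divergence. -/
theorem eval_vacuum_const (hj : T.IsFourVector j) (x : Spacetime n) (μ : Fin (n + 1)) :
    j.eval (fun _ => T.vacuum) x μ = j.eval (fun _ => T.vacuum) 0 μ := by
  have h := hj 1 x _ T.isHistory_vacuum.1 0 μ
  rw [poincareAct_vacuum, map_zero, zero_add] at h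
  have h1 : ∀ v : Spacetime n, (1 : Spacetime n ≃L[ℝ] Spacetime n) v = v := fun _ => rfl
  simpa [h1, Pi.single_apply] using h

/-- The current of a history has vanishing divergence. -/
theorem divergence_eq_zero_of_isHistory [FiniteDimensional ℝ G] (hj : T.IsFourVector j)
    (hflux : ∀ Φ, T.IsHistory Φ → ∀ t, ∫ x : Space n, T.excess j Φ (event t x) 0 = 0)
    {Φ : Spacetime n → κ → G} (hΦ : T.IsHistory Φ) (x : Spacetime n) :
    j.divergence Φ x = 0 := by
  have : CompleteSpace G := FiniteDimensional.complete ℝ G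
  -- Linear functionals reduce the claim to a real vector field.
  refine SeparatingDual.eq_zero_of_forall_dual_eq_zero (R := ℝ) fun ℓ => ?_
  have hJ : ∀ Ψ, T.IsHistory Ψ → ContDiff ℝ ∞ fun x μ => ℓ (T.excess j Ψ x μ) := fun Ψ hΨ =>
    contDiff_pi.mpr fun μ => ℓ.contDiff.comp (contDiff_pi.mp (contDiff_excess hΨ) μ)
  have hJc : ∀ Ψ, T.IsHistory Ψ → HasCompactSupport fun x μ => ℓ (T.excess j Ψ x μ) :=
    fun Ψ hΨ => (hasCompactSupport_excess hΨ).comp_left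
      (g := fun (v : Fin (n + 1) → G) μ => ℓ (v μ)) (by ext; simp)
  -- The weight is constant on each time slice, where the flux vanishes.
  have hmom : ∀ Ψ, T.IsHistory Ψ → ∀ m : ℕ, ∫ x, ℓ (T.excess j Ψ x 0) * x 0 ^ m = 0 := by
    intro Ψ hΨ m
    have hc := contDiff_pi.mp (hJ Ψ hΨ) 0
    have hcc : HasCompactSupport fun x => ℓ (T.excess j Ψ x 0) :=
      (hJc Ψ hΨ).comp_left (g := fun v : Fin (n + 1) → ℝ => v 0) rfl
    refine integral_eq_zero_of_integral_event_eq_zero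
      ((hc.continuous.mul (by fun_prop)).integrable_of_hasCompactSupport hcc.mul_right)
      fun t => ?_
    have hi : Integrable fun x : Space n => T.excess j Ψ (event t x) 0 :=
      ((contDiff_pi.mp (contDiff_excess hΨ) 0).continuous.comp
        (contDiff_event t).continuous).integrable_of_hasCompactSupport
        (hasCompactSupport_comp_event ((hasCompactSupport_excess hΨ).comp_left
          (g := fun v : Fin (n + 1) → G => v 0) rfl) t)
    have h0 : ∀ x : Space n, event t x 0 = t := fun x => rfl
    simp only [h0]
    rw [integral_mul_const, ℓ.integral_comp_comm hi, hflux Ψ hΨ t, map_zero, zero_mul]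
  have hdiv := divergence_eq_zero_of_moments (hJ Φ hΦ) (hJc Φ hΦ) (fun ξ hξ m => by
    obtain ⟨A, hA, r, hrow⟩ := exists_restrictedLorentz_of_isFutureTimelike hξ
    obtain ⟨s, rfl⟩ := (T.lorentz_range A).mpr hA
    have hξν : ∀ ν, ξ ν = r * T.lorentz s (Pi.single ν 1) 0 := fun ν => by
      -- As ξ is r times the time row of the Lorentz matrix, its moment is that of the transformed
      -- history, times one r from ξ·J and m from the power.
      rw [← hrow]; simp
    have h1 := hmom _ (hΦ.poincareAct s 0) m
    rw [← integral_comp_lorentz hA] at h1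
    refine Eq.trans (integral_congr_ae (Filter.Eventually.of_forall fun x => ?_))
      ((integral_const_mul (r ^ (m + 1)) _).trans (by rw [h1, mul_zero]))
    dsimp only
    rw [hrow x]
    simp only [excess_poincareAct hj hΦ, dotProduct, hξν, map_sum, map_smul, smul_eq_mul,
      mul_assoc, ← Finset.mul_sum]
    ring) x
  have hd : ∀ μ, DifferentiableAt ℝ (fun y => j.eval Φ y μ) x := fun μ =>
    (contDiff_pi.mp (j.contDiff_eval hΦ.1.1) μ).differentiable (by simp) x
  rw [LocalCurrent.divergence, map_sum, ← hdiv]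
  refine Finset.sum_congr rfl fun μ _ => ?_
  have e : (fun y => ℓ (T.excess j Φ y μ)) =
      fun y => ℓ (j.eval Φ y μ) - ℓ (j.eval (fun _ => T.vacuum) 0 μ) := by
    funext y
    rw [excess, Pi.sub_apply, eval_vacuum_const hj y, map_sub]
  rw [e, fderiv_sub_const]
  exact (DFunLike.congr_fun (ℓ.hasFDerivAt.comp x (hd μ).hasFDerivAt).fderiv _).symm

/-- Every field agrees near a given point with a history. -/
theorem exists_isHistory_eventuallyEq {Φ : Spacetime n → κ → G} (hΦ : IsField 𝒢 T.parity Φ)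
    (x : Spacetime n) : ∃ Ψ, T.IsHistory Ψ ∧ Φ =ᶠ[nhds x] Ψ := by
  let χ : ContDiffBump x := ⟨1, 2, one_pos, one_lt_two⟩
  -- The cutoff interpolates towards the vacuum rather than towards 0, with real coefficients so
  -- that parities are kept.
  refine ⟨fun y => T.vacuum + χ y • (Φ y - T.vacuum), ⟨⟨?_, fun y a => ?_⟩, ?_⟩, ?_⟩
  · exact contDiff_const.add (χ.contDiff.smul (hΦ.1.sub contDiff_const))
  · exact (𝒢 _).add_mem (T.vacuum_parity a)
      ((𝒢 _).smul_mem _ ((𝒢 _).sub_mem (hΦ.2 y a) (T.vacuum_parity a)))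
  · simp only [add_sub_cancel_left]
    exact χ.hasCompactSupport.smul_right
  · filter_upwards [χ.eventuallyEq_one] with y hy
    simp [hy]

end RelativisticFieldTheory

end FieldTheory

theorem theorem2 (n : ℕ) {κ : Type*} [Fintype κ] [DecidableEq κ]
    {G : Type*} [NormedRing G] [NormedAlgebra ℝ G] [FiniteDimensional ℝ G]
    (𝒢 : ZMod 2 → Submodule ℝ G) [GradedAlgebra 𝒢]
    (hG : FieldTheory.IsSupercommutative 𝒢)
    {S : Type*} [Group S]
    (T : FieldTheory.RelativisticFieldTheory n κ 𝒢 S)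
    (j : FieldTheory.LocalCurrent n κ G) (hj : T.IsFourVector j)
    (Q : ℝ → (FieldTheory.Space n → κ → G) → (FieldTheory.Space n → κ → G) → G)
    (hQ : T.IsCanonicalCharge j Q)
    (hφ : ∀ t φ π, T.IsPhasePoint t φ π → ∀ a,
      FieldTheory.HasBracketWithField 𝒢 T.parity (Q t) φ π a 0)
    (hπ : ∀ t φ π, T.IsPhasePoint t φ π → ∀ a,
      FieldTheory.HasBracketWithMomentum 𝒢 T.parity (Q t) φ π a 0) :
    T.StronglyConserved j := by
  intro Φ hΦ x
  obtain ⟨Ψ, hΨ, e⟩ := FieldTheory.RelativisticFieldTheory.exists_isHistory_eventuallyEq hΦ x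
  rw [j.divergence_congr e]
  exact FieldTheory.RelativisticFieldTheory.divergence_eq_zero_of_isHistory hj
    (fun _ h => FieldTheory.RelativisticFieldTheory.integral_excess_eq_zero hQ hφ hπ h) hΨ x
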